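/- Let $F$ be a number field, let $m \ge 1$ be an integer and $p$ a prime not dividing $m$, and let $G = \langle a\rangle_m \rtimes \langle b\rangle_p$ be the internal semidirect product of a normal cyclic subgroup $\langle a\rangle$ of order $m$ and a cyclic subgroup $\langle b\rangle$ of order $p$. Assume that $b^{-1}ab = a^r$ for an integer $r$ with $\gcd(r-1,m)=1$. Let $\zeta_p$ and $\zeta_m$ be primitive $p$-th and $m$-th roots of unity in an extension field $\Omega$ of $F$. The number of simple components (in the Wedderburn decomposition) of the group algebra $FG$ is called minimal if it equals the number of simple components of $\mathbb{Q}G$. Let $\langle b\rangle$ act on $\mathbb{Q}(\zeta_m)$ by $b\cdot\zeta_m=\zeta_m^r$, with fixed field $\mathbb{Q}(\zeta_m)^{\langle b\rangle}$, and let $I_p(F)$ be the image of $\operatorname{Gal}(F(\zeta_p)/F)$ in $(\mathbb{Z}/p\mathbb{Z})^\times$ under $\sigma\mapsto t$, where $\sigma(\zeta_p)=\zeta_p^t$. Then the number of simple components of $FG$ is minimal if and only if $$\mathbb{Q}(\zeta_p)\cap F=\mathbb{Q}\quad\text{and}\quad \mathbb{Q}(\zeta_m)^{\langle b\rangle}\cap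 F=\mathbb{Q}$$ (intersections taken inside $\Omega$). Moreover, the condition $\mathbb{Q}(\zeta_p)\cap F=\mathbb{Q}$ is equivalent to $|I_p(F)|=p-1$. -/

import Mathlib

open IntermediateField

/-- The number of simple components of a ring `R`: the number of its minimal nonzero two-sided
ideals.  For a semisimple ring these are exactly the simple rings `R e`, with `e` a primitive
central idempotent, whose product is the Wedderburn decomposition of `R`. -/
noncomputable def numSimpleComponents (R : Type*) [Ring R] : ℕ :=
  Nat.card {I : TwoSidedIdeal R // IsAtom I}

/-- The number of simple components of the group algebra `F G` is minimal: it equals the number of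
simple components of the rational group algebra `ℚ G`. -/
def HasMinimalSimpleComponents (F : Type*) [Field F] (G : Type*) [Group G] : Prop :=
  numSimpleComponents (MonoidAlgebra F G) = numSimpleComponents (MonoidAlgebra ℚ G)

/-- For a primitive `k`-th root of unity `ζ` in an extension of `F`, the set `I_k(F)`: the image of
`Gal(F(ζ)/F)` in `(ℤ/kℤ)ˣ`, an automorphism `σ` being sent to the class `t` with `σ ζ = ζ ^ t`. -/
def cyclotomicGaloisImage (F : Type*) [Field F] {Ω : Type*} [Field Ω] [Algebra F Ω]
    (k : ℕ) (ζ : Ω) : Set (ZMod k)ˣ :=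
  {t | ∃ σ : F⟮ζ⟯ ≃ₐ[F] F⟮ζ⟯, σ (AdjoinSimple.gen F ζ) = AdjoinSimple.gen F ζ ^ (t : ZMod k).val}

/-- The subgroup of `Gal(ℚ(ζ)/ℚ)` generated by the automorphism `ζ ↦ ζ ^ r`. If `ζ` is a primitive
`m`-th root of unity and `r` is prime to `m`, this automorphism exists and is unique; see
`existsUnique_algEquiv_gen_zpow` and `powAutGroup_eq_zpowers`. -/
def powAutGroup {Ω : Type*} [Field Ω] [CharZero Ω] (ζ : Ω) (r : ℤ) :
    Subgroup (ℚ⟮ζ⟯ ≃ₐ[ℚ] ℚ⟮ζ⟯) :=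
  Subgroup.closure {σ | σ (AdjoinSimple.gen ℚ ζ) = AdjoinSimple.gen ℚ ζ ^ r}

/-- The subfield of `ℚ(ζ)` fixed by the automorphism `ζ ↦ ζ ^ r` (and the cyclic group that it
generates), as a subfield of the ambient field. -/
noncomputable def powFixedField {Ω : Type*} [Field Ω] [CharZero Ω] (ζ : Ω) (r : ℤ) :
    IntermediateField ℚ Ω :=
  IntermediateField.lift (IntermediateField.fixedField (powAutGroup ζ r))

/-- The image of the number field `F` in an extension field `Ω`, as an extension of `ℚ`. -/
noncomputable def imageField (F Ω : Type*) [Field F] [NumberField F] [Field Ω] [CharZero Ω]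
    [Algebra F Ω] : IntermediateField ℚ Ω :=
  (algebraMap F Ω).toRatAlgHom.fieldRange

theorem existsUnique_algEquiv_gen_zpow {Ω : Type*} [Field Ω] [CharZero Ω] {m : ℕ} (hm : m ≠ 0)
    {ζ : Ω} (hζ : IsPrimitiveRoot ζ m) {r : ℤ} (hr : IsCoprime r (m : ℤ)) :
    ∃! σ : ℚ⟮ζ⟯ ≃ₐ[ℚ] ℚ⟮ζ⟯, σ (AdjoinSimple.gen ℚ ζ) = AdjoinSimple.gen ℚ ζ ^ r := by
  have : NeZero m := ⟨hm⟩
  have hg : AdjoinSimple.gen ℚ ζ ^ m = 1 :=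
    Subtype.ext (by simpa using hζ.pow_eq_one)
  have hg0 : AdjoinSimple.gen ℚ ζ ≠ 0 := by
    intro h
    rw [h, zero_pow hm] at hg
    exact zero_ne_one hg
  have : IsCyclotomicExtension {m} ℚ ℚ⟮ζ⟯ := by
    change IsCyclotomicExtension {m} ℚ ℚ⟮ζ⟯.toSubalgebra
    rw [IntermediateField.adjoin_simple_toSubalgebra_of_isAlgebraic
      (hζ.isIntegral (NeZero.pos m)).tower_top.isAlgebraic]
    exact hζ.adjoin_isCyclotomicExtension ℚ
  have : NumberField ℚ⟮ζ⟯ := IsCyclotomicExtension.numberField {m} ℚ ℚ⟮ζ⟯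
  obtain ⟨u, hu⟩ : IsUnit ((r : ℤ) : ZMod m) := (ZMod.coe_int_isUnit_iff_isCoprime r m).2 hr.symm
  have hgal : ∀ u : (ZMod m)ˣ, (u : ZMod m) = (r : ZMod m) →
      (IsCyclotomicExtension.Rat.galEquivZMod m ℚ⟮ζ⟯).symm u (AdjoinSimple.gen ℚ ζ) =
        AdjoinSimple.gen ℚ ζ ^ r := by
    intro u hu
    have h := IsCyclotomicExtension.Rat.galEquivZMod_apply_of_pow_eq m ℚ⟮ζ⟯
      ((IsCyclotomicExtension.Rat.galEquivZMod m ℚ⟮ζ⟯).symm u) hg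
    rw [MulEquiv.apply_symm_apply, hu] at h
    refine h.trans ?_
    rw [← zpow_natCast]
    have hd : (m : ℤ) ∣ r - (((r : ZMod m).val : ℕ) : ℤ) := by
      rw [← ZMod.intCast_zmod_eq_zero_iff_dvd]
      push_cast
      rw [ZMod.natCast_zmod_val, sub_self]
    obtain ⟨c, hc⟩ := hd
    have : r = (((r : ZMod m).val : ℕ) : ℤ) + m * c := by omega
    conv_rhs => rw [this, zpow_add₀ hg0, zpow_mul, zpow_natCast _ m, hg, one_zpow, mul_one]
  refine ⟨(IsCyclotomicExtension.Rat.galEquivZMod m ℚ⟮ζ⟯).symm u, hgal u hu, ?_⟩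
  · intro τ hτ
    have key : ∀ σ : ℚ⟮ζ⟯ ≃ₐ[ℚ] ℚ⟮ζ⟯,
        σ (AdjoinSimple.gen ℚ ζ) = AdjoinSimple.gen ℚ ζ ^ r → τ = σ := by
      intro σ hσ
      have h : (τ : ℚ⟮ζ⟯ →ₐ[ℚ] ℚ⟮ζ⟯) = (σ : ℚ⟮ζ⟯ →ₐ[ℚ] ℚ⟮ζ⟯) := by
        refine IntermediateField.adjoin_algHom_ext ℚ fun x hx => ?_
        obtain rfl : x = ζ := hx
        exact hτ.trans hσ.symm
      exact AlgEquiv.ext fun x => DFunLike.congr_fun h x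
    exact key _ (hgal _ hu)

theorem powAutGroup_eq_zpowers {Ω : Type*} [Field Ω] [CharZero Ω] {m : ℕ} (hm : m ≠ 0)
    {ζ : Ω} (hζ : IsPrimitiveRoot ζ m) {r : ℤ} (hr : IsCoprime r (m : ℤ))
    {σ : ℚ⟮ζ⟯ ≃ₐ[ℚ] ℚ⟮ζ⟯} (hσ : σ (AdjoinSimple.gen ℚ ζ) = AdjoinSimple.gen ℚ ζ ^ r) :
    powAutGroup ζ r = Subgroup.zpowers σ := by
  rw [Subgroup.zpowers_eq_closure, powAutGroup]
  congr 1
  ext τ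
  exact ⟨fun h => (existsUnique_algEquiv_gen_zpow hm hζ hr).unique h hσ, fun h => by
    rw [Set.mem_singleton_iff.1 h]; exact hσ⟩

/-!
A semisimple ring with `n` simple components has exactly `2 ^ n` central idempotents
(`card_centralIdempotents`), and those of `ℚ G` stay central idempotents in `F G`. Hence the number
of simple components of `F G` is minimal if and only if every central idempotent of `F G` has
rational coefficients (`hasMinimalSimpleComponents_iff`). Inside `Ω G` this says that a central
idempotent with coefficients in the image of `F` is rational.

Let `e` be a central idempotent of `Ω G`. It is constant on every coset of `⟨a⟩` other than `⟨a⟩`,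
because `r ^ i - 1` is prime to `m` for `p ∤ i`. On the eigenprojectors for the linear characters
`a ↦ 1`, `b ↦ ζ_p ^ s`, and for the nontrivial characters of `⟨a⟩`, it acts by a scalar that is `0`
or `1`. Fourier inversion expresses the coefficients of `e` through these scalars: outside `⟨a⟩` they
lie in `ℚ(ζ_p)`, on `⟨a⟩` in the subfield of `ℚ(ζ_m)` fixed by `ζ_m ↦ ζ_m ^ r`
(`IsMetacyclicPair.coeff_mem_adjoin`, `IsMetacyclicPair.coeff_pow_mem_powFixedField`). If both fields
meet `F` in `ℚ`, then `e` is rational as soon as its coefficients lie in `F`.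

Conversely let `L` be the intersection of `F` with one of the two fields, contained in `ℚ(ζ)`. The
sum of the eigenprojectors for the eigenvalues `σ ζ`, with `σ` in the Galois group of `ℚ(ζ)` over
`L`, has coefficients in `L` and leads to a central idempotent. If it is rational, its set of
eigenvalues is stable under the whole Galois group of `ℚ(ζ)` (`eq_top_of_sum_pow_mem_range`), so
`L = ℚ`.

Finally `|I_p(F)| = [F(ζ_p) : F]`, and since `ℚ(ζ_p)` is Galois over `ℚ`, it meets `F` in `ℚ` if and
only if the two are linearly disjoint, that is, if and only if this degree is still `p - 1`.
-/

/-! ### Central idempotents of semisimple rings -/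

/-- The central idempotents of a ring. -/
def centralIdempotents (R : Type*) [Ring R] : Set R :=
  {e | IsIdempotentElem e ∧ ∀ x, Commute e x}

/-- The two-sided ideal generated by a central idempotent `e`, described as the set of elements
fixed by multiplication by `e`. -/
def twoSidedIdealOfCentralIdempotent {R : Type*} [Ring R] (e : centralIdempotents R) :
    TwoSidedIdeal R :=
  .mk' {x | e * x = x} (mul_zero _)
    (fun {x y} hx hy => by simp only [Set.mem_ofPred_eq] at *; rw [mul_add, hx, hy])
    (fun {x} hx => by simp only [Set.mem_ofPred_eq] at *; rw [mul_neg, hx])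
    (fun {x y} hy => by
      simp only [Set.mem_ofPred_eq] at *; rw [← mul_assoc, e.2.2 x, mul_assoc, hy])
    (fun {x y} hx => by simp only [Set.mem_ofPred_eq] at *; rw [← mul_assoc, hx])

theorem mem_twoSidedIdealOfCentralIdempotent {R : Type*} [Ring R] {e : centralIdempotents R}
    {x : R} : x ∈ twoSidedIdealOfCentralIdempotent e ↔ e * x = x :=
  TwoSidedIdeal.mem_mk' ..

/-- Two-sided ideals of a semisimple ring correspond to sets of isotypic components of the
ring as a left module over itself. -/
noncomputable def twoSidedIdealOrderIsoSetIsotypic (R : Type*) [Ring R] [IsSemisimpleRing R] :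
    TwoSidedIdeal R ≃o Set (isotypicComponents R R) :=
  (TwoSidedIdeal.orderIsoIsTwoSided.trans
    { toFun := fun I => ⟨I.1, isFullyInvariant_iff_isTwoSided.2 I.2⟩
      invFun := fun I => ⟨I.1, isFullyInvariant_iff_isTwoSided.1 I.2⟩
      left_inv := fun _ => rfl
      right_inv := fun _ => rfl
      map_rel_iff' := Iff.rfl }).trans
    (OrderIso.setIsotypicComponents (R := R) (M := R)).symm

theorem numSimpleComponents_eq_card_isotypicComponents (R : Type*) [Ring R] [IsSemisimpleRing R] :
    numSimpleComponents R = Nat.card (isotypicComponents R R) := by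
  let o := twoSidedIdealOrderIsoSetIsotypic R
  have e₁ : {I : TwoSidedIdeal R // IsAtom I} ≃ {s : Set (isotypicComponents R R) // IsAtom s} :=
    o.toEquiv.subtypeEquiv fun I => (o.isAtom_iff I).symm
  rw [numSimpleComponents, Nat.card_congr e₁]
  refine (Nat.card_congr (Equiv.ofBijective (fun c => ⟨{c}, Set.isAtom_singleton c⟩) ⟨?_, ?_⟩)).symm
  · intro c d h
    exact Set.singleton_injective (congrArg Subtype.val h)
  · rintro ⟨s, hs⟩
    obtain ⟨c, rfl⟩ := Set.isAtom_iff.1 hs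
    exact ⟨c, rfl⟩

/-- In a semisimple ring a two-sided ideal has a two-sided complement, and the components of `1`
in the resulting decomposition are central idempotents. -/
theorem twoSidedIdealOfCentralIdempotent_bijective (R : Type*) [Ring R] [IsSemisimpleRing R] :
    Function.Bijective (twoSidedIdealOfCentralIdempotent (R := R)) := by
  constructor
  · intro e f h
    have hef : (f : R) * e = e := mem_twoSidedIdealOfCentralIdempotent.1
      (h ▸ mem_twoSidedIdealOfCentralIdempotent.2 e.2.1)
    have hfe : (e : R) * f = f := mem_twoSidedIdealOfCentralIdempotent.1
      (h ▸ mem_twoSidedIdealOfCentralIdempotent.2 f.2.1)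
    exact Subtype.ext (by rw [← hef, f.2.2, hfe])
  · intro I
    let o := twoSidedIdealOrderIsoSetIsotypic R
    obtain ⟨J, hIJ⟩ : ∃ J, IsCompl I J :=
      ⟨o.symm (o I)ᶜ, by simpa using o.symm.isCompl (isCompl_compl (x := o I))⟩
    have hzero : ∀ x, x ∈ I → x ∈ J → x = 0 := fun x hx hy =>
      (TwoSidedIdeal.mem_bot R).1 (hIJ.inf_eq_bot ▸ (TwoSidedIdeal.mem_inf R).2 ⟨hx, hy⟩)
    have hone : (1 : R) ∈ I ⊔ J := hIJ.sup_eq_top ▸ TwoSidedIdeal.mem_top R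
    obtain ⟨e, he, f, hf, hef⟩ := TwoSidedIdeal.mem_sup.1 hone
    have hleft : ∀ x ∈ I, e * x = x := fun x hx => by
      have : f * x = 0 := hzero _ (I.mul_mem_left _ _ hx) (J.mul_mem_right _ _ hf)
      rw [← add_zero (e * x), ← this, ← add_mul, hef, one_mul]
    have hright : ∀ x ∈ I, x * e = x := fun x hx => by
      have : x * f = 0 := hzero _ (I.mul_mem_right _ _ hx) (J.mul_mem_left _ _ hf)
      rw [← add_zero (x * e), ← this, ← mul_add, hef, mul_one]
    refine ⟨⟨e, hleft e he, fun x => ?_⟩, ?_⟩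
    · rw [Commute, SemiconjBy, ← hright _ (I.mul_mem_right e x he), mul_assoc,
        hleft _ (I.mul_mem_left x e he)]
    · ext x
      rw [mem_twoSidedIdealOfCentralIdempotent]
      exact ⟨fun h => h ▸ I.mul_mem_right e x he, hleft x⟩

theorem finite_centralIdempotents (R : Type*) [Ring R] [IsSemisimpleRing R] :
    Finite (centralIdempotents R) :=
  Finite.of_equiv _ ((Equiv.ofBijective _ (twoSidedIdealOfCentralIdempotent_bijective R)).trans
    (twoSidedIdealOrderIsoSetIsotypic R).toEquiv).symm

theorem card_centralIdempotents (R : Type*) [Ring R] [IsSemisimpleRing R] :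
    Nat.card (centralIdempotents R) = 2 ^ numSimpleComponents R := by
  have := Fintype.ofFinite (isotypicComponents R R)
  rw [numSimpleComponents_eq_card_isotypicComponents,
    Nat.card_congr ((Equiv.ofBijective _ (twoSidedIdealOfCentralIdempotent_bijective R)).trans
      (twoSidedIdealOrderIsoSetIsotypic R).toEquiv), Nat.card_eq_fintype_card,
    Nat.card_eq_fintype_card, Fintype.card_set]

/-! ### Minimality in terms of coefficients of central idempotents -/

theorem MonoidAlgebra.commute_of_forall_commute_single {k G : Type*} [CommRing k] [Monoid G]
    {e : MonoidAlgebra k G} (h : ∀ g, Commute e (single g 1)) (x : MonoidAlgebra k G) :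
    Commute e x := by
  induction x using MonoidAlgebra.induction_linear with
  | zero => exact Commute.zero_right e
  | add x y hx hy => exact hx.add_right hy
  | single g r =>
    have : (single g r : MonoidAlgebra k G) = r • single g 1 := by simp
    rw [this]
    exact (h g).smul_right r

theorem MonoidAlgebra.mapRingHom_mem_centralIdempotents_iff {k K G : Type*} [Field k] [Field K]
    [Monoid G] (f : k →+* K) {e : MonoidAlgebra k G} :
    mapRingHom G f e ∈ centralIdempotents (MonoidAlgebra K G) ↔
      e ∈ centralIdempotents (MonoidAlgebra k G) := by
  have hinj : Function.Injective (mapRingHom G f) := map_injective (f : k →+ K) f.injective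
  refine ⟨fun h => ⟨hinj ?_, fun x => hinj ?_⟩, fun h => ⟨h.1.map _, ?_⟩⟩
  · rw [map_mul]
    exact h.1
  · rw [map_mul, map_mul]
    exact h.2 _
  · refine commute_of_forall_commute_single fun g => ?_
    simpa using (h.2 (single g 1)).map (mapRingHom G f)

/-- Since a ring with `n` simple components has `2 ^ n` central idempotents, the number of simple
components of `F G` is that of `ℚ G` exactly when scalar extension creates no new central
idempotents. -/
theorem hasMinimalSimpleComponents_iff (F : Type*) [Field F] [CharZero F] (G : Type*) [Group G]
    [Finite G] :
    HasMinimalSimpleComponents F G ↔ ∀ e ∈ centralIdempotents (MonoidAlgebra F G),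
      ∀ g, e.coeff g ∈ (algebraMap ℚ F).range := by
  have hinj : Function.Injective (MonoidAlgebra.mapRingHom G (algebraMap ℚ F)) :=
    MonoidAlgebra.map_injective (algebraMap ℚ F : ℚ →+ F) (algebraMap ℚ F).injective
  let φ : centralIdempotents (MonoidAlgebra ℚ G) → centralIdempotents (MonoidAlgebra F G) :=
    fun e => ⟨_, (MonoidAlgebra.mapRingHom_mem_centralIdempotents_iff (algebraMap ℚ F)).2 e.2⟩
  have hφ : Function.Injective φ := fun e f h => Subtype.ext (hinj (congrArg Subtype.val h))
  have : Finite (centralIdempotents (MonoidAlgebra ℚ G)) := finite_centralIdempotents _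
  have : Finite (centralIdempotents (MonoidAlgebra F G)) := finite_centralIdempotents _
  have hcard : HasMinimalSimpleComponents F G ↔ Function.Surjective φ := by
    rw [HasMinimalSimpleComponents, ← (Nat.pow_right_injective le_rfl).eq_iff,
      ← card_centralIdempotents, ← card_centralIdempotents]
    exact ⟨fun h => ((Nat.bijective_iff_injective_and_card φ).2 ⟨hφ, h.symm⟩).2,
      fun h => (Nat.card_eq_of_bijective φ ⟨hφ, h⟩).symm⟩
  rw [hcard]
  constructor
  · intro h e he g
    obtain ⟨f, hf⟩ := h ⟨e, he⟩
    have : e = MonoidAlgebra.mapRingHom G (algebraMap ℚ F) f := (congrArg Subtype.val hf).symm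
    exact ⟨f.1.coeff g, by rw [this, MonoidAlgebra.coeff_mapRingHom]⟩
  · rintro h ⟨e, he⟩
    obtain ⟨f, rfl⟩ : e ∈ Set.range (MonoidAlgebra.map (M := G) (algebraMap ℚ F : ℚ →+ F)) := by
      rw [MonoidAlgebra.range_map]
      exact h e he
    exact ⟨⟨f, (MonoidAlgebra.mapRingHom_mem_centralIdempotents_iff (algebraMap ℚ F)).1 he⟩, rfl⟩

/-! ### Idempotents attached to an element of finite order -/

/-- For an element `X` of a `K`-algebra with `X ^ n = 1` and an `n`-th root of unity `ξ`, the
projector `n⁻¹ ∑ ξ⁻ⁱ Xⁱ` onto the `ξ`-eigenspace of multiplication by `X`. -/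
noncomputable def eigenProjector {K A : Type*} [Field K] [Ring A] [Algebra K A] (n : ℕ) (X : A)
    (ξ : K) : A :=
  (n : K)⁻¹ • ∑ i ∈ Finset.range n, ξ⁻¹ ^ i • X ^ i

theorem eq_one_of_sum_pow_ne_zero {K : Type*} [Field K] {n : ℕ} {ξ : K} (hξ : ξ ^ n = 1)
    (h : ∑ i ∈ Finset.range n, ξ ^ i ≠ 0) : ξ = 1 := by
  have := geom_sum_mul ξ n
  rw [hξ, sub_self, mul_eq_zero] at this
  exact sub_eq_zero.1 (this.resolve_left h)

section EigenProjector

variable {K A : Type*} [Field K] [CharZero K] [Ring A] [Algebra K A] {n : ℕ} {X : A} {ξ : K}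

theorem mul_eigenProjector (hn : n ≠ 0) (hX : X ^ n = 1) (hξ : ξ ^ n = 1) :
    X * eigenProjector n X ξ = ξ • eigenProjector n X ξ := by
  have hξ0 : ξ ≠ 0 := by rintro rfl; simp [hn] at hξ
  have h : (ξ⁻¹ • X) * ∑ i ∈ Finset.range n, (ξ⁻¹ • X) ^ i =
      ∑ i ∈ Finset.range n, (ξ⁻¹ • X) ^ i := by
    have := mul_geom_sum (ξ⁻¹ • X) n
    rwa [smul_pow, hX, inv_pow, hξ, inv_one, one_smul, sub_self, sub_mul, one_mul,
      sub_eq_zero] at this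
  simp only [smul_pow] at h
  rw [smul_mul_assoc, inv_smul_eq_iff₀ hξ0] at h
  rw [eigenProjector, mul_smul_comm, h, smul_comm]

theorem pow_mul_eigenProjector (hn : n ≠ 0) (hX : X ^ n = 1) (hξ : ξ ^ n = 1) (i : ℕ) :
    X ^ i * eigenProjector n X ξ = ξ ^ i • eigenProjector n X ξ := by
  induction i with
  | zero => simp
  | succ i ih =>
    rw [pow_succ, mul_assoc, mul_eigenProjector hn hX hξ, mul_smul_comm, ih, smul_smul, pow_succ']

theorem eigenProjector_pow_mul_eigenProjector (hn : n ≠ 0) (hX : X ^ n = 1) (hξ : ξ ^ n = 1)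
    (k : ℕ) : eigenProjector n (X ^ k) (ξ ^ k) * eigenProjector n X ξ = eigenProjector n X ξ := by
  have hξ0 : ξ ≠ 0 := by rintro rfl; simp [hn] at hξ
  have hn' : (n : K) ≠ 0 := Nat.cast_ne_zero.2 hn
  conv_lhs => rw [eigenProjector]
  rw [smul_mul_assoc, Finset.sum_mul, Finset.sum_congr rfl (g := fun _ => eigenProjector n X ξ),
    Finset.sum_const, Finset.card_range, ← Nat.cast_smul_eq_nsmul K, inv_smul_smul₀ hn']
  intro i _
  rw [← pow_mul, smul_mul_assoc, pow_mul_eigenProjector hn hX hξ, smul_smul, inv_pow, ← pow_mul,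
    inv_mul_cancel₀ (pow_ne_zero _ hξ0), one_smul]

theorem isIdempotentElem_eigenProjector (hn : n ≠ 0) (hX : X ^ n = 1) (hξ : ξ ^ n = 1) :
    IsIdempotentElem (eigenProjector n X ξ) := by
  simpa [IsIdempotentElem] using eigenProjector_pow_mul_eigenProjector hn hX hξ 1

theorem eigenProjector_mul_eigenProjector_of_ne (hn : n ≠ 0) (hX : X ^ n = 1) {ξ' : K}
    (hξ : ξ ^ n = 1) (hξ' : ξ' ^ n = 1) (h : ξ ≠ ξ') :
    eigenProjector n X ξ' * eigenProjector n X ξ = 0 := by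
  have hξ0 : ξ' ≠ 0 := by rintro rfl; simp [hn] at hξ'
  have hsum : ∑ i ∈ Finset.range n, (ξ'⁻¹ * ξ) ^ i = 0 := by
    by_contra h0
    have := eq_one_of_sum_pow_ne_zero (by rw [mul_pow, inv_pow, hξ, hξ', inv_one, one_mul]) h0
    exact h (by rwa [inv_mul_eq_one₀ hξ0, eq_comm] at this)
  conv_lhs => enter [1]; rw [eigenProjector]
  simp_rw [smul_mul_assoc, Finset.sum_mul, smul_mul_assoc, pow_mul_eigenProjector hn hX hξ,
    smul_smul, ← Finset.sum_smul, ← mul_pow, hsum, zero_smul, smul_zero]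

omit [CharZero K] in
theorem Commute.eigenProjector_right {Y : A} (h : Commute Y X) (n : ℕ) (ξ : K) :
    Commute Y (eigenProjector n X ξ) :=
  (Commute.sum_right _ _ _ fun i _ => (h.pow_right i).smul_right _).smul_right _

/-- Two projectors for powers of `X` that generate the same cyclic group agree, provided that the
eigenvalues correspond. -/
theorem eigenProjector_pow (hn : n ≠ 0) (hX : X ^ n = 1) (hξ : ξ ^ n = 1) {k : ℕ}
    (hk : k.Coprime n) : eigenProjector n (X ^ k) (ξ ^ k) = eigenProjector n X ξ := by
  obtain ⟨l, hl⟩ : ∃ l, k * l % n = 1 % n := by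
    rcases (Nat.one_le_iff_ne_zero.2 hn).eq_or_lt with rfl | h1
    · exact ⟨0, by omega⟩
    · obtain ⟨l, -, hl⟩ := Nat.exists_mul_mod_eq_one_of_coprime hk h1
      exact ⟨l, by rw [hl, Nat.mod_eq_of_lt h1]⟩
  have hXl : (X ^ k) ^ l = X := by
    rw [← pow_mul, pow_eq_pow_mod _ hX, hl, ← pow_eq_pow_mod _ hX, pow_one]
  have hξl : (ξ ^ k) ^ l = ξ := by
    rw [← pow_mul, pow_eq_pow_mod _ hξ, hl, ← pow_eq_pow_mod _ hξ, pow_one]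
  have h₁ := eigenProjector_pow_mul_eigenProjector hn hX hξ k
  have h₂ := eigenProjector_pow_mul_eigenProjector (X := X ^ k) (ξ := ξ ^ k) hn
    (by rw [pow_right_comm, hX, one_pow]) (by rw [pow_right_comm, hξ, one_pow]) l
  rw [hXl, hξl] at h₂
  have hcomm : Commute (eigenProjector n X ξ) (eigenProjector n (X ^ k) (ξ ^ k)) :=
    (((Commute.refl X).pow_left k).eigenProjector_right n ξ).symm.eigenProjector_right n (ξ ^ k)
  rw [← h₂, hcomm.eq, h₁]

/-- If `X B = B X ^ k`, then conjugation by `B` permutes the projectors of `X`. -/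
theorem eigenProjector_pow_mul_of_mul_eq (hn : n ≠ 0) (hX : X ^ n = 1) (hξ : ξ ^ n = 1) {k : ℕ}
    (hk : k.Coprime n) {B : A} (hB : X * B = B * X ^ k) :
    eigenProjector n X (ξ ^ k) * B = B * eigenProjector n X ξ := by
  have hpow : ∀ i : ℕ, X ^ i * B = B * (X ^ k) ^ i := fun i =>
    (SemiconjBy.pow_right (show SemiconjBy B (X ^ k) X from hB.symm) i).symm
  rw [← eigenProjector_pow hn hX hξ hk, eigenProjector, eigenProjector, smul_mul_assoc,
    mul_smul_comm, Finset.sum_mul, Finset.mul_sum]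
  simp_rw [smul_mul_assoc, mul_smul_comm, hpow]

end EigenProjector

/-- An eigenvalue of an idempotent is `0` or `1`. -/
theorem eq_zero_or_one_of_idempotent_mul_eq_smul {K A : Type*} [Field K] [Ring A] [Algebra K A]
    {e w : A} {c : K} (he : IsIdempotentElem e) (hw : w ≠ 0) (h : e * w = c • w) :
    c = 0 ∨ c = 1 := by
  have h2 : c • (c • w) = c • w := by
    rw [← h, ← mul_smul_comm, ← h, ← mul_assoc, he]
  rw [smul_smul, ← sub_eq_zero, ← sub_smul, smul_eq_zero] at h2
  have : c * (c - 1) = 0 := by linear_combination h2.resolve_right hw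
  simpa [sub_eq_zero] using this

/-! ### Finite Fourier analysis -/

/-- Fourier inversion for functions on `ℤ / n`, viewed as `n`-periodic functions on `ℤ`. -/
theorem fourier_inversion {K : Type*} [Field K] [CharZero K] {n : ℕ} (hn : n ≠ 0) {ζ : K}
    (hζ : IsPrimitiveRoot ζ n) {f : ℤ → K} (hf : Function.Periodic f n) (j : ℤ) :
    f j = (n : K)⁻¹ * ∑ s ∈ Finset.range n, (ζ ^ s)⁻¹ ^ j *
      ∑ i ∈ Finset.range n, f i * (ζ ^ s) ^ i := by
  have hn' : (n : K) ≠ 0 := Nat.cast_ne_zero.2 hn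
  have hζ0 : ζ ≠ 0 := hζ.ne_zero hn
  have hpos : (0 : ℤ) < n := by positivity
  set i₀ := (j % n).toNat with hi₀
  have hi₀' : (i₀ : ℤ) = j % n := Int.toNat_of_nonneg (Int.emod_nonneg _ hpos.ne')
  have hlt : i₀ < n := by have := Int.emod_lt_of_pos j hpos; omega
  have hfj : f j = f i₀ := by
    rw [hi₀', ← Int.emod_add_mul_ediv j n, mul_comm]
    simpa using hf.int_mul (j / n) (j % n)
  have hpow : ∀ s : ℕ, (ζ ^ s)⁻¹ ^ j = (ζ ^ s)⁻¹ ^ i₀ := fun s => by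
    have h1 : ((ζ ^ s)⁻¹) ^ n = 1 := by rw [inv_pow, pow_right_comm, hζ.pow_eq_one]; simp
    rw [← zpow_natCast _ i₀, hi₀']
    conv_lhs => rw [← Int.emod_add_mul_ediv j n]
    rw [zpow_add₀ (by simp [hζ0]), zpow_mul, zpow_natCast _ n, h1, one_zpow, mul_one]
  rw [hfj, eq_inv_mul_iff_mul_eq₀ hn']
  simp_rw [hpow, Finset.mul_sum]
  rw [Finset.sum_comm, Finset.sum_eq_single_of_mem i₀ (Finset.mem_range.2 hlt)]
  · rw [Finset.sum_congr rfl (g := fun _ => f i₀)]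
    · simp
    · intro s _
      rw [mul_left_comm, ← mul_pow, inv_mul_cancel₀ (pow_ne_zero _ hζ0), one_pow, mul_one]
  · intro i hi hne
    have hsum : ∑ s ∈ Finset.range n, ((ζ ^ i₀)⁻¹ * ζ ^ i) ^ s = 0 := by
      by_contra h0
      have := eq_one_of_sum_pow_ne_zero (by
        rw [mul_pow, inv_pow, pow_right_comm, hζ.pow_eq_one, pow_right_comm, hζ.pow_eq_one]
        simp) h0
      rw [inv_mul_eq_one₀ (pow_ne_zero _ hζ0)] at this
      exact hne (hζ.pow_inj hlt (Finset.mem_range.1 hi) this).symm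
    rw [← mul_zero (f i), ← hsum, Finset.mul_sum]
    refine Finset.sum_congr rfl fun s _ => ?_
    rw [mul_pow, inv_pow, inv_pow, ← pow_mul, ← pow_mul, ← pow_mul, ← pow_mul, mul_comm i₀,
      mul_comm i]
    ring

/-- If the indicator function of a group `H` of automorphisms of `k(ζ)`, seen on the `n`-th roots of
unity, has Fourier coefficients in `k`, then `H` consists of all automorphisms: a polynomial
over `k` that takes the value `1` at `ζ` takes it at every conjugate of `ζ`. -/
theorem eq_top_of_sum_pow_mem_range {k K : Type*} [Field k] [Field K] [CharZero K]
    [Algebra k K] {n : ℕ} (hn : n ≠ 0) {ζ : K}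
    (hζ : ζ ^ n = 1) (hinj : ∀ σ τ : K ≃ₐ[k] K, σ ζ = τ ζ → σ = τ) (H : Subgroup (K ≃ₐ[k] K))
    [Fintype H]
    (hH : ∀ i < n, ∑ σ : H, ((σ : K ≃ₐ[k] K) ζ)⁻¹ ^ i ∈ (algebraMap k K).range) : H = ⊤ := by
  classical
  have hn' : (n : K) ≠ 0 := Nat.cast_ne_zero.2 hn
  have hζ0 : ζ ≠ 0 := by rintro rfl; simp [hn] at hζ
  have hroot : ∀ τ : K ≃ₐ[k] K, τ ζ ^ n = 1 := fun τ => by rw [← map_pow, hζ, map_one]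
  have hval : ∀ τ : K ≃ₐ[k] K, ∑ i ∈ Finset.range n,
      (∑ σ : H, ((σ : K ≃ₐ[k] K) ζ)⁻¹ ^ i) * τ ζ ^ i = if τ ∈ H then (n : K) else 0 := by
    intro τ
    have hinner : ∀ σ : H, ∑ i ∈ Finset.range n, ((σ : K ≃ₐ[k] K) ζ)⁻¹ ^ i * τ ζ ^ i =
        if (σ : K ≃ₐ[k] K) = τ then (n : K) else 0 := by
      intro σ
      have hσ0 : (σ : K ≃ₐ[k] K) ζ ≠ 0 := by simpa using hζ0
      simp_rw [← mul_pow]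
      split_ifs with h
      · rw [h] at hσ0 ⊢
        simp [inv_mul_cancel₀ hσ0]
      · by_contra h0
        have := eq_one_of_sum_pow_ne_zero (by rw [mul_pow, inv_pow, hroot, hroot]; simp) h0
        rw [inv_mul_eq_one₀ hσ0] at this
        exact h (hinj _ _ this)
    simp_rw [Finset.sum_mul]
    rw [Finset.sum_comm]
    simp_rw [hinner]
    split_ifs with h
    · rw [Finset.sum_eq_single_of_mem ⟨τ, h⟩ (Finset.mem_univ _)]
      · simp
      · intro σ _ hne
        exact if_neg fun h' => hne (Subtype.ext h')
    · exact Finset.sum_eq_zero fun σ _ => if_neg fun (h' : (σ : K ≃ₐ[k] K) = τ) => h (h' ▸ σ.2)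
  refine Subgroup.eq_top_iff' H |>.2 fun τ => ?_
  have h1 := congrArg τ (hval 1)
  rw [if_pos H.one_mem, map_natCast, map_sum] at h1
  have h2 : ∑ i ∈ Finset.range n, τ ((∑ σ : H, ((σ : K ≃ₐ[k] K) ζ)⁻¹ ^ i) *
      (1 : K ≃ₐ[k] K) ζ ^ i) = ∑ i ∈ Finset.range n,
      (∑ σ : H, ((σ : K ≃ₐ[k] K) ζ)⁻¹ ^ i) * τ ζ ^ i := by
    refine Finset.sum_congr rfl fun i hi => ?_
    obtain ⟨q, hq⟩ := hH i (Finset.mem_range.1 hi)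
    rw [← hq, map_mul, map_pow, AlgEquiv.commutes, AlgEquiv.one_apply]
  rw [h2, hval τ] at h1
  by_contra h
  rw [if_neg h] at h1
  exact hn' h1.symm

/-! ### Cyclotomic fields and the image of the Galois group -/

theorem IsPrimitiveRoot.isCyclotomicExtension_adjoin_simple (k : Type*) [Field k] {Ω : Type*}
    [Field Ω] [Algebra k Ω] {n : ℕ} [NeZero n] {ζ : Ω} (hζ : IsPrimitiveRoot ζ n) :
    IsCyclotomicExtension {n} k k⟮ζ⟯ := by
  change IsCyclotomicExtension {n} k k⟮ζ⟯.toSubalgebra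
  rw [adjoin_simple_toSubalgebra_of_isAlgebraic
    (hζ.isIntegral (NeZero.pos n)).tower_top.isAlgebraic]
  exact hζ.adjoin_isCyclotomicExtension k

/-- The group `I_k(F)` is in bijection with `Gal(F(ζ)/F)`, hence its order is the degree of
`F(ζ)`. -/
theorem ncard_cyclotomicGaloisImage (F : Type*) [Field F] {Ω : Type*} [Field Ω] [Algebra F Ω]
    {n : ℕ} [NeZero n] {ζ : Ω} (hζ : IsPrimitiveRoot ζ n) :
    (cyclotomicGaloisImage F n ζ).ncard = Module.finrank F F⟮ζ⟯ := by
  have hcyc : IsCyclotomicExtension {n} F F⟮ζ⟯ :=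
    hζ.isCyclotomicExtension_adjoin_simple F
  have := IsCyclotomicExtension.isGalois {n} F F⟮ζ⟯
  have := IsCyclotomicExtension.finiteDimensional {n} F F⟮ζ⟯
  have hg : IsPrimitiveRoot (AdjoinSimple.gen F ζ) n :=
    IsPrimitiveRoot.coe_submonoidClass_iff.1 (by simpa using hζ)
  have hrange : cyclotomicGaloisImage F n ζ = Set.range (hg.autToPow F) := by
    ext t
    constructor
    · rintro ⟨σ, hσ⟩
      refine ⟨σ, Units.ext (ZMod.val_injective n ?_)⟩
      exact hg.pow_inj (ZMod.val_lt _) (ZMod.val_lt _) ((hg.autToPow_spec F σ).trans hσ)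
    · rintro ⟨σ, rfl⟩
      exact ⟨σ, (hg.autToPow_spec F σ).symm⟩
  rw [hrange, ← Nat.card_coe_set_eq, ← IsGalois.card_aut_eq_finrank]
  exact (Nat.card_congr (Equiv.ofInjective _ (hg.autToPow_injective F))).symm

theorem IsPrimitiveRoot.isGalois_adjoin_simple (k : Type*) [Field k] {Ω : Type*} [Field Ω]
    [Algebra k Ω] {n : ℕ} (hn : n ≠ 0) {ζ : Ω} (hζ : IsPrimitiveRoot ζ n) :
    FiniteDimensional k k⟮ζ⟯ ∧ IsGalois k k⟮ζ⟯ := by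
  have : NeZero n := ⟨hn⟩
  have := hζ.isCyclotomicExtension_adjoin_simple k
  exact ⟨IsCyclotomicExtension.finiteDimensional {n} k k⟮ζ⟯,
    IsCyclotomicExtension.isGalois {n} k k⟮ζ⟯⟩

theorem IntermediateField.inf_fieldRange_eq_bot_iff_linearDisjoint {k F Ω : Type*} [Field k]
    [Field F] [Field Ω] [Algebra k F] [Algebra k Ω] [Algebra F Ω] [IsScalarTower k F Ω]
    [FiniteDimensional k F] (A : IntermediateField k Ω) [IsGalois k A] [FiniteDimensional k A] :
    A ⊓ (IsScalarTower.toAlgHom k F Ω).fieldRange = ⊥ ↔ A.LinearDisjoint F := by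
  have hfin : FiniteDimensional k (IsScalarTower.toAlgHom k F Ω).fieldRange :=
    (AlgEquiv.ofInjectiveField (IsScalarTower.toAlgHom k F Ω)).toLinearEquiv.finiteDimensional
  rw [← LinearDisjoint.iff_inf_eq_bot, linearDisjoint_iff']
  exact Iff.rfl

/-- The field `k(ζ)` meets `F` only in `k` if and only if `ζ` has the same degree over `F` as over
`k`. -/
theorem IsPrimitiveRoot.adjoin_inf_fieldRange_eq_bot_iff_finrank {k F Ω : Type*} [Field k]
    [Field F] [Field Ω] [Algebra k F] [Algebra k Ω] [Algebra F Ω] [IsScalarTower k F Ω]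
    [FiniteDimensional k F] {n : ℕ} (hn : n ≠ 0) {ζ : Ω} (hζ : IsPrimitiveRoot ζ n) :
    k⟮ζ⟯ ⊓ (IsScalarTower.toAlgHom k F Ω).fieldRange = ⊥ ↔
      Module.finrank F F⟮ζ⟯ = Module.finrank k k⟮ζ⟯ := by
  obtain ⟨_, _⟩ := hζ.isGalois_adjoin_simple k hn
  have hk : IsIntegral k ζ := (hζ.isIntegral (Nat.pos_of_ne_zero hn)).tower_top
  have hF : IsIntegral F ζ := (hζ.isIntegral (Nat.pos_of_ne_zero hn)).tower_top
  rw [inf_fieldRange_eq_bot_iff_linearDisjoint]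
  constructor
  · intro h
    have hle : adjoin F (k⟮ζ⟯ : Set Ω) = F⟮ζ⟯ := by
      refine le_antisymm (adjoin_le_iff.2 ?_) (adjoin.mono _ _ _ ?_)
      · have : k⟮ζ⟯ ≤ F⟮ζ⟯.restrictScalars k :=
          adjoin_le_iff.2 (Set.singleton_subset_iff.2 (mem_adjoin_simple_self F ζ))
        exact this
      · exact Set.singleton_subset_iff.2 (mem_adjoin_simple_self k ζ)
    rw [Module.finrank, Module.finrank, ← h.adjoin_rank_eq_rank_left_of_isAlgebraic_left, hle]
  · intro h
    rw [adjoin.finrank hF, adjoin.finrank hk] at h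
    refine LinearDisjoint.of_basis_left (adjoin.powerBasis hk).basis ?_
    have hli := (linearIndependent_pow (K := F) ζ).comp (Fin.cast h.symm) (Fin.cast_injective _)
    have hb : (k⟮ζ⟯.val ∘ (adjoin.powerBasis hk).basis : Fin (minpoly k ζ).natDegree → Ω) =
        (fun i : Fin (minpoly F ζ).natDegree => ζ ^ (i : ℕ)) ∘ Fin.cast h.symm := by
      funext i
      simp only [PowerBasis.coe_basis, adjoin.powerBasis_gen]
      rfl
    exact hb ▸ hli

theorem imageField_eq_fieldRange (F Ω : Type*) [Field F] [NumberField F] [Field Ω] [CharZero Ω]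
    [Algebra F Ω] : imageField F Ω = (IsScalarTower.toAlgHom ℚ F Ω).fieldRange := by
  ext x
  exact Iff.rfl

/-- The `ℚ`-module structure is named explicitly: it is the one of an intermediate field, not the one
that every field of characteristic zero carries. -/
theorem IsPrimitiveRoot.finrank_rat_adjoin {Ω : Type*} [Field Ω] [CharZero Ω] {n : ℕ} [NeZero n]
    {ζ : Ω} (hζ : IsPrimitiveRoot ζ n) :
    @Module.finrank ℚ ℚ⟮ζ⟯ _ _ (ℚ⟮ζ⟯.algebra').toModule = n.totient := by
  have := hζ.isCyclotomicExtension_adjoin_simple ℚ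
  exact IsCyclotomicExtension.finrank ℚ⟮ζ⟯
    (Polynomial.cyclotomic.irreducible_rat (NeZero.pos n))

theorem adjoin_inf_imageField_eq_bot_iff_ncard (F : Type*) [Field F] [NumberField F] {Ω : Type*}
    [Field Ω] [CharZero Ω] [Algebra F Ω] {n : ℕ} [NeZero n] {ζ : Ω} (hζ : IsPrimitiveRoot ζ n) :
    ℚ⟮ζ⟯ ⊓ imageField F Ω = ⊥ ↔ (cyclotomicGaloisImage F n ζ).ncard = n.totient := by
  rw [ncard_cyclotomicGaloisImage F hζ, imageField_eq_fieldRange, ← hζ.finrank_rat_adjoin]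
  exact hζ.adjoin_inf_fieldRange_eq_bot_iff_finrank (NeZero.ne n)

/-! ### Subfields of a cyclotomic field and idempotents -/

section Subfield

variable {k Ω : Type*} [Field k] [Field Ω] [CharZero Ω] [Algebra k Ω] {n : ℕ} {ζ : Ω}

omit [CharZero Ω] in
theorem algEquiv_adjoin_simple_ext {σ τ : k⟮ζ⟯ ≃ₐ[k] k⟮ζ⟯}
    (h : σ (AdjoinSimple.gen k ζ) = τ (AdjoinSimple.gen k ζ)) : σ = τ := by
  have h' : (σ : k⟮ζ⟯ →ₐ[k] k⟮ζ⟯) = (τ : k⟮ζ⟯ →ₐ[k] k⟮ζ⟯) := by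
    refine IntermediateField.adjoin_algHom_ext k fun x hx => ?_
    obtain rfl : x = ζ := hx
    exact h
  exact AlgEquiv.ext fun x => DFunLike.congr_fun h' x

/-- The `i`-th Fourier coefficient of the indicator function of `{σ ζ | σ ∈ H}`. -/
noncomputable def orbitCoeff (n : ℕ) (H : Subgroup (k⟮ζ⟯ ≃ₐ[k] k⟮ζ⟯)) [Fintype H] (i : ℕ) : Ω :=
  (n : Ω)⁻¹ * ∑ σ : H, (((σ : k⟮ζ⟯ ≃ₐ[k] k⟮ζ⟯) (AdjoinSimple.gen k ζ) : k⟮ζ⟯) : Ω)⁻¹ ^ i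

/-- The sum of the eigenprojectors of `X` for the eigenvalues `σ ζ`, where `σ` runs through the
group `H`. -/
noncomputable def orbitProjector {A : Type*} [Ring A] [Algebra Ω A] (n : ℕ) (X : A)
    (H : Subgroup (k⟮ζ⟯ ≃ₐ[k] k⟮ζ⟯)) [Fintype H] : A :=
  ∑ σ : H, eigenProjector n X (((σ : k⟮ζ⟯ ≃ₐ[k] k⟮ζ⟯) (AdjoinSimple.gen k ζ) : k⟮ζ⟯) : Ω)

variable (H : Subgroup (k⟮ζ⟯ ≃ₐ[k] k⟮ζ⟯)) [Fintype H]

omit [CharZero Ω] in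
theorem Commute.sum_smul_pow {A : Type*} [Ring A] [Algebra Ω A] {X Y : A} (h : Commute Y X)
    (s : Finset ℕ) (c : ℕ → Ω) : Commute Y (∑ i ∈ s, c i • X ^ i) :=
  Commute.sum_right _ _ _ fun i _ => (h.pow_right i).smul_right _

omit [CharZero Ω] in
theorem orbitProjector_eq_sum {A : Type*} [Ring A] [Algebra Ω A] (X : A) :
    orbitProjector n X H = ∑ i ∈ Finset.range n, orbitCoeff n H i • X ^ i := by
  simp only [orbitProjector, eigenProjector, orbitCoeff, ← Finset.smul_sum, mul_smul,
    Finset.sum_smul]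
  rw [Finset.sum_comm]

omit [CharZero Ω] in
theorem pow_conjugate_gen (hζ : ζ ^ n = 1) (σ : k⟮ζ⟯ ≃ₐ[k] k⟮ζ⟯) :
    ((σ (AdjoinSimple.gen k ζ) : k⟮ζ⟯) : Ω) ^ n = 1 := by
  have hg : AdjoinSimple.gen k ζ ^ n = 1 := Subtype.ext (by simpa using hζ)
  rw [← SubmonoidClass.coe_pow, ← map_pow, hg, map_one]
  rfl

theorem isIdempotentElem_orbitProjector (hn : n ≠ 0) (hζ : ζ ^ n = 1) {A : Type*} [Ring A]
    [Algebra Ω A] {X : A} (hX : X ^ n = 1) : IsIdempotentElem (orbitProjector n X H) := by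
  rw [IsIdempotentElem, orbitProjector, Finset.sum_mul_sum]
  refine Finset.sum_congr rfl fun σ _ => ?_
  rw [Finset.sum_eq_single_of_mem σ (Finset.mem_univ _)]
  · exact isIdempotentElem_eigenProjector hn hX (pow_conjugate_gen hζ _)
  · intro τ _ hne
    refine eigenProjector_mul_eigenProjector_of_ne hn hX (pow_conjugate_gen hζ _)
      (pow_conjugate_gen hζ _) fun h => hne (Subtype.ext ?_)
    exact algEquiv_adjoin_simple_ext (Subtype.ext h)

omit [CharZero Ω] in
theorem orbitCoeff_mem {L : IntermediateField k Ω} (hn : n ≠ 0) (hζ : IsPrimitiveRoot ζ n)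
    (hL : L ≤ k⟮ζ⟯) [Fintype (restrict hL).fixingSubgroup] (i : ℕ) :
    orbitCoeff n (restrict hL).fixingSubgroup i ∈ L := by
  obtain ⟨_, _⟩ := hζ.isGalois_adjoin_simple k hn
  let y : k⟮ζ⟯ := (n : k⟮ζ⟯)⁻¹ * ∑ σ : (restrict hL).fixingSubgroup,
    ((σ : k⟮ζ⟯ ≃ₐ[k] k⟮ζ⟯) (AdjoinSimple.gen k ζ))⁻¹ ^ i
  have hy : (y : Ω) = orbitCoeff n (restrict hL).fixingSubgroup i := by
    simp [y, orbitCoeff]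
  have hfix : y ∈ restrict hL := by
    rw [← IsGalois.fixedField_fixingSubgroup (restrict hL), mem_fixedField_iff]
    intro τ hτ
    simp only [y, map_mul, map_inv₀, map_natCast, map_sum, map_pow]
    congr 1
    exact Fintype.sum_equiv (Equiv.mulLeft (⟨τ, hτ⟩ : (restrict hL).fixingSubgroup)) _ _ fun σ => rfl
  rw [← hy, ← mem_restrict hL]
  exact hfix

theorem eq_bot_of_orbitCoeff_mem_bot {L : IntermediateField k Ω} (hn : n ≠ 0)
    (hζ : IsPrimitiveRoot ζ n) (hL : L ≤ k⟮ζ⟯) [Fintype (restrict hL).fixingSubgroup]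
    (h : ∀ i < n, orbitCoeff n (restrict hL).fixingSubgroup i ∈ (⊥ : IntermediateField k Ω)) :
    L = ⊥ := by
  obtain ⟨_, _⟩ := hζ.isGalois_adjoin_simple k hn
  have hn' : (n : Ω) ≠ 0 := Nat.cast_ne_zero.2 hn
  have htop : (restrict hL).fixingSubgroup = ⊤ := by
    refine eq_top_of_sum_pow_mem_range hn (ζ := AdjoinSimple.gen k ζ)
      (Subtype.ext (by simpa using hζ.pow_eq_one)) (fun _ _ => algEquiv_adjoin_simple_ext) _
      fun i hi => ?_
    obtain ⟨q, hq⟩ := mem_bot.1 (h i hi)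
    refine ⟨n * q, Subtype.ext ?_⟩
    rw [orbitCoeff, eq_inv_mul_iff_mul_eq₀ hn'] at hq
    simpa using hq
  rw [← lift_restrict hL, ← IsGalois.fixedField_fixingSubgroup (restrict hL), htop,
    IsGalois.fixedField_top, lift_bot]

end Subfield

section PowFixedField

variable {Ω : Type*} [Field Ω] [CharZero Ω] {ζ : Ω}

/-- An element of `ℚ(ζ)` lies in the field fixed by `ζ ↦ ζ ^ r` as soon as that automorphism fixes
it. -/
theorem coe_mem_powFixedField {r : ℤ} {y : ℚ⟮ζ⟯}
    (h : ∀ σ : ℚ⟮ζ⟯ ≃ₐ[ℚ] ℚ⟮ζ⟯, σ (AdjoinSimple.gen ℚ ζ) = AdjoinSimple.gen ℚ ζ ^ r → σ y = y) :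
    (y : Ω) ∈ powFixedField ζ r := by
  have hle : powAutGroup ζ r ≤ MulAction.stabilizer (ℚ⟮ζ⟯ ≃ₐ[ℚ] ℚ⟮ζ⟯) y :=
    (Subgroup.closure_le _).2 h
  exact (mem_lift y).2 ((mem_fixedField_iff _ y).2 fun σ hσ => hle hσ)

/-- If `L` lies in the field fixed by `ζ ↦ ζ ^ r`, then that automorphism belongs to the Galois group
of `ℚ(ζ)` over `L`. -/
theorem exists_mem_fixingSubgroup_gen_zpow {n : ℕ} (hn : n ≠ 0) (hζ : IsPrimitiveRoot ζ n) {r : ℤ}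
    (hr : IsCoprime r (n : ℤ)) {L : IntermediateField ℚ Ω} (hL : L ≤ ℚ⟮ζ⟯)
    (h : L ≤ powFixedField ζ r) :
    ∃ σ ∈ (restrict hL).fixingSubgroup, σ (AdjoinSimple.gen ℚ ζ) = AdjoinSimple.gen ℚ ζ ^ r := by
  obtain ⟨σ, hσ, -⟩ := existsUnique_algEquiv_gen_zpow hn hζ hr
  have hmem : σ ∈ powAutGroup ζ r := Subgroup.subset_closure hσ
  refine ⟨σ, ?_, hσ⟩
  refine (IntermediateField.mem_fixingSubgroup_iff _ _).2 fun y hy => ?_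
  have hy' : (y : Ω) ∈ powFixedField ζ r := h ((mem_restrict hL y).1 hy)
  exact (mem_fixedField_iff _ _).1 ((mem_lift y).1 hy') σ hmem

end PowFixedField

/-! ### The metacyclic group -/

/-- The group `G` is the semidirect product of the cyclic groups generated by `a` and `b`, of orders
`m` and `p`, where `b⁻¹ a b = a ^ r` and `r - 1` is prime to `m`; the product decomposition is
expressed by the normal form `a ^ j * b ^ i` of the elements of `G`. -/
structure IsMetacyclicPair {G : Type*} [Group G] (a b : G) (m p r : ℕ) : Prop where
  ne_zero : m ≠ 0
  prime : p.Prime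
  orderOf_left : orderOf a = m
  orderOf_right : orderOf b = p
  bijOn : Set.BijOn (fun x : ℕ × ℕ => a ^ x.1 * b ^ x.2)
    (Finset.range m ×ˢ Finset.range p : Finset (ℕ × ℕ)) Set.univ
  mul_comm_pow : a * b = b * a ^ r
  coprime : r.Coprime m
  isCoprime_sub_one : IsCoprime ((r : ℤ) - 1) (m : ℤ)

namespace IsMetacyclicPair

section Group

variable {G : Type*} [Group G] {a b : G} {m p r : ℕ} (h : IsMetacyclicPair a b m p r)

include h

theorem pow_left : a ^ m = 1 := h.orderOf_left ▸ pow_orderOf_eq_one a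

theorem pow_right : b ^ p = 1 := h.orderOf_right ▸ pow_orderOf_eq_one b

theorem semiconjBy (i : ℕ) : SemiconjBy (b ^ i) (a ^ r ^ i) a := by
  induction i with
  | zero => simp
  | succ i ih =>
    rw [pow_succ b]
    refine ih.mul_left ?_
    rw [pow_succ r, mul_comm, pow_mul]
    exact (show SemiconjBy b (a ^ r) a from h.mul_comm_pow.symm).pow_right (r ^ i)

theorem dvd_pow_sub_one : (m : ℤ) ∣ (r : ℤ) ^ p - 1 := by
  have hs := h.semiconjBy p
  rw [h.pow_right] at hs
  have hpow : a ^ r ^ p = a ^ 1 := by simpa [SemiconjBy] using hs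
  have := (pow_eq_pow_iff_modEq.1 hpow).symm
  rw [h.orderOf_left] at this
  simpa using (Nat.modEq_iff_dvd.1 this)

/-- The nontrivial powers of `b` act on `⟨a⟩` without fixed points, as `b` does: `b` is a
power of such a power. -/
theorem isCoprime_pow_sub_one {i : ℕ} (hi : ¬ p ∣ i) : IsCoprime ((r : ℤ) ^ i - 1) (m : ℤ) := by
  obtain ⟨k, -, hk⟩ := Nat.exists_mul_mod_eq_one_of_coprime
    ((h.prime.coprime_iff_not_dvd.2 hi).symm) h.prime.one_lt
  set t := i * k / p
  have hik : i * k = p * t + 1 := by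
    rw [← hk]
    exact (Nat.div_add_mod (i * k) p).symm
  have h1 : ((r : ℤ) ^ i) ^ k - 1 = (r - 1) + r * (((r : ℤ) ^ p) ^ t - 1) := by
    rw [← pow_mul, hik, pow_succ, pow_mul]
    ring
  obtain ⟨c, hc⟩ : (m : ℤ) ∣ ((r : ℤ) ^ p) ^ t - 1 :=
    h.dvd_pow_sub_one.trans (by simpa using sub_dvd_pow_sub_pow ((r : ℤ) ^ p) 1 t)
  refine IsCoprime.of_isCoprime_of_dvd_left (y := ((r : ℤ) ^ i) ^ k - 1) ?_
    (by simpa using sub_dvd_pow_sub_pow ((r : ℤ) ^ i) 1 k)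
  rw [h1, hc, show (r : ℤ) * (m * c) = m * (r * c) by ring]
  exact h.isCoprime_sub_one.add_mul_left_left _

/-- Each coset `⟨a⟩ b ^ i` other than `⟨a⟩` lies in a single conjugacy class: its elements are conjugate
to `b ^ i` by powers of `a`. -/
theorem exists_conj {i : ℕ} (hi : ¬ p ∣ i) (j : ℕ) :
    ∃ k : ℤ, a ^ j * b ^ i = a ^ k * (b ^ i * a ^ (-k)) := by
  obtain ⟨u, v, huv⟩ := h.isCoprime_pow_sub_one hi
  -- The condition on `k` is `k * (r ^ i - 1) ≡ j * r ^ i` modulo `m`.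
  refine ⟨j * r ^ i * u, ?_⟩
  set k : ℤ := j * r ^ i * u with hk
  have hs := h.semiconjBy i
  have h1 : a ^ k * b ^ i = b ^ i * (a ^ r ^ i) ^ k := ((hs.zpow_right k).eq).symm
  have h2 : a ^ j * b ^ i = b ^ i * (a ^ r ^ i) ^ j := ((hs.pow_right j).eq).symm
  rw [← mul_assoc, h1, h2, mul_assoc]
  congr 1
  rw [← zpow_natCast, ← zpow_natCast, ← zpow_mul, ← zpow_mul, ← zpow_add,
    ← orderOf_dvd_sub_iff_zpow_eq_zpow, h.orderOf_left]
  refine ⟨j * r ^ i * v, ?_⟩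
  push_cast
  rw [hk]
  linear_combination (-(j : ℤ) * r ^ i) * huv

end Group

section Algebra

open MonoidAlgebra

variable {Ω : Type*} [Field Ω] [CharZero Ω] {G : Type*} [Group G] {a b : G} {m p r : ℕ}
  (h : IsMetacyclicPair a b m p r)

omit [CharZero Ω] in
theorem _root_.MonoidAlgebra.coeff_sum_smul_of {ι : Type*} {s : Finset ι} {f : ι → G}
    (hf : Set.InjOn f s) (c : ι → Ω) {i₀ : ι} (hi₀ : i₀ ∈ s) :
    (∑ i ∈ s, c i • of Ω G (f i)).coeff (f i₀) = c i₀ := by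
  classical
  rw [coeff_sum, Finsupp.finsetSum_apply, Finset.sum_eq_single_of_mem i₀ hi₀]
  · simp
  · intro i hi hne
    have : f i ≠ f i₀ := fun h => hne (hf hi hi₀ h)
    simp [this]

theorem _root_.MonoidAlgebra.coeff_sum_smul_of_mem {ι : Type*} {s : Finset ι} {f : ι → G}
    {L : IntermediateField ℚ Ω} {c : ι → Ω} (hc : ∀ i ∈ s, c i ∈ L) (g : G) :
    (∑ i ∈ s, c i • of Ω G (f i)).coeff g ∈ L := by
  classical
  rw [coeff_sum, Finsupp.finsetSum_apply]
  refine sum_mem fun i hi => ?_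
  rw [coeff_smul, of_apply, coeff_single, Finsupp.smul_apply, Finsupp.single_apply, smul_eq_mul]
  split_ifs
  · simpa using hc i hi
  · simp

omit [CharZero Ω] in
/-- The coefficients of a central element form a class function. -/
theorem _root_.MonoidAlgebra.coeff_mul_comm_of_commute {e : MonoidAlgebra Ω G}
    (he : ∀ x, Commute e x) (x y : G) : e.coeff (x * y) = e.coeff (y * x) := by
  have h1 := coeff_mul_single_mul e (1 : Ω) x⁻¹ (y * x)
  have h2 := coeff_single_mul_mul e (1 : Ω) x⁻¹ (x * y)
  rw [(he (single x⁻¹ 1)).eq] at h1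
  rw [mul_inv_cancel_right, mul_one] at h1
  rw [inv_mul_cancel_left, one_mul] at h2
  rw [← h1, ← h2]

include h

omit [CharZero Ω] in
theorem of_left_pow : of Ω G a ^ m = 1 := by rw [← map_pow, h.pow_left, map_one]

omit [CharZero Ω] in
theorem of_right_pow : of Ω G b ^ p = 1 := by rw [← map_pow, h.pow_right, map_one]

omit [CharZero Ω] in
theorem eq_sum (e : MonoidAlgebra Ω G) :
    e = ∑ x ∈ Finset.range m ×ˢ Finset.range p,
      e.coeff (a ^ x.1 * b ^ x.2) • of Ω G (a ^ x.1 * b ^ x.2) := by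
  ext g
  obtain ⟨x, hx, rfl⟩ := h.bijOn.surjOn (Set.mem_univ g)
  exact (coeff_sum_smul_of (f := fun x : ℕ × ℕ => a ^ x.1 * b ^ x.2) h.bijOn.injOn
    (fun x => e.coeff (a ^ x.1 * b ^ x.2)) hx).symm

theorem eigenProjector_pow_mul_of {ξ : Ω} (hξ : ξ ^ m = 1) :
    eigenProjector m (of Ω G a) (ξ ^ r) * of Ω G b =
      of Ω G b * eigenProjector m (of Ω G a) ξ :=
  eigenProjector_pow_mul_of_mul_eq h.ne_zero h.of_left_pow hξ h.coprime
    (by rw [← map_pow, ← map_mul, ← map_mul, h.mul_comm_pow])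

theorem commute_eigenProjector_one :
    Commute (eigenProjector m (of Ω G a) (1 : Ω)) (of Ω G b) := by
  simpa [Commute, SemiconjBy] using h.eigenProjector_pow_mul_of (ξ := (1 : Ω)) (one_pow m)

theorem of_left_pow_mul_eigenProjector_one (j : ℕ) :
    of Ω G a ^ j * eigenProjector m (of Ω G a) (1 : Ω) = eigenProjector m (of Ω G a) (1 : Ω) := by
  have := pow_mul_eigenProjector h.ne_zero (h.of_left_pow (Ω := Ω)) (one_pow (M := Ω) m) j
  rwa [one_pow, one_smul] at this

omit [CharZero Ω] h in
theorem eigenProjector_one_mul_sum (d : ℕ → Ω) :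
    eigenProjector m (of Ω G a) (1 : Ω) * ∑ i ∈ Finset.range p, d i • of Ω G b ^ i =
      ∑ x ∈ Finset.range m ×ˢ Finset.range p,
        ((m : Ω)⁻¹ * d x.2) • of Ω G (a ^ x.1 * b ^ x.2) := by
  rw [eigenProjector, smul_mul_assoc, Finset.sum_mul_sum, Finset.sum_product, Finset.smul_sum]
  refine Finset.sum_congr rfl fun j _ => ?_
  rw [Finset.smul_sum]
  refine Finset.sum_congr rfl fun i _ => ?_
  rw [inv_one, one_pow, one_smul, mul_smul_comm, smul_smul, map_mul, map_pow, map_pow]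

omit [CharZero Ω] in
theorem coeff_eigenProjector_one_mul_sum (d : ℕ → Ω) {i : ℕ} (hi : i < p) :
    (eigenProjector m (of Ω G a) (1 : Ω) *
      ∑ i ∈ Finset.range p, d i • of Ω G b ^ i).coeff (b ^ i) = (m : Ω)⁻¹ * d i := by
  rw [eigenProjector_one_mul_sum]
  have := coeff_sum_smul_of (f := fun x : ℕ × ℕ => a ^ x.1 * b ^ x.2) h.bijOn.injOn
    (fun x => (m : Ω)⁻¹ * d x.2) (i₀ := (0, i)) (by
      simpa [hi] using Nat.pos_of_ne_zero h.ne_zero)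
  simpa using this

omit [CharZero Ω] in
theorem coeff_sum_smul_of_left_pow (c : ℕ → Ω) {j : ℕ} (hj : j < m) :
    (∑ i ∈ Finset.range m, c i • of Ω G a ^ i).coeff (a ^ j) = c j := by
  simp_rw [← map_pow]
  refine coeff_sum_smul_of (f := fun i : ℕ => a ^ i) (fun i hi k hk hik => ?_) c
    (Finset.mem_range.2 hj)
  rw [Finset.coe_range] at hi hk
  exact pow_injOn_Iio_orderOf (h.orderOf_left ▸ hi) (h.orderOf_left ▸ hk) hik

theorem eigenProjector_left_ne_zero (ξ : Ω) : eigenProjector m (of Ω G a) ξ ≠ 0 := by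
  intro h0
  rw [eigenProjector, smul_eq_zero] at h0
  have hm : (m : Ω)⁻¹ ≠ 0 := inv_ne_zero (Nat.cast_ne_zero.2 h.ne_zero)
  have := h.coeff_sum_smul_of_left_pow (fun i => ξ⁻¹ ^ i) (Nat.pos_of_ne_zero h.ne_zero)
  rw [h0.resolve_left hm] at this
  simp at this

theorem eigenProjector_one_mul_ne_zero (ξ : Ω) :
    eigenProjector m (of Ω G a) (1 : Ω) * eigenProjector p (of Ω G b) ξ ≠ 0 := by
  intro h0
  have hm : (m : Ω) ≠ 0 := Nat.cast_ne_zero.2 h.ne_zero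
  have hp : (p : Ω)⁻¹ ≠ 0 := inv_ne_zero (Nat.cast_ne_zero.2 h.prime.ne_zero)
  have := h.coeff_eigenProjector_one_mul_sum (fun i => ξ⁻¹ ^ i) h.prime.pos
  rw [eigenProjector.eq_def p, mul_smul_comm, smul_eq_zero] at h0
  rw [h0.resolve_left hp] at this
  exact hm (by simpa using this : (0 : Ω) = m).symm

/-! ### Coefficients of central idempotents -/

/-- An element of the group algebra acts on the line of the linear character `a ↦ 1`, `b ↦ ξ` by the
value of that character. -/
theorem mul_eigenProjector_mul (e : MonoidAlgebra Ω G) {ξ : Ω} (hξ : ξ ^ p = 1) :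
    e * (eigenProjector m (of Ω G a) (1 : Ω) * eigenProjector p (of Ω G b) ξ) =
      (∑ i ∈ Finset.range p, (∑ j ∈ Finset.range m, e.coeff (a ^ j * b ^ i)) * ξ ^ i) •
        (eigenProjector m (of Ω G a) (1 : Ω) * eigenProjector p (of Ω G b) ξ) := by
  conv_lhs => rw [h.eq_sum e]
  rw [Finset.sum_mul, Finset.sum_product_right, Finset.sum_smul]
  refine Finset.sum_congr rfl fun i _ => ?_
  rw [Finset.sum_mul, Finset.sum_smul]
  refine Finset.sum_congr rfl fun j _ => ?_
  have hb := pow_mul_eigenProjector h.prime.ne_zero h.of_right_pow hξ (X := of Ω G b) i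
  rw [smul_mul_assoc, mul_smul, map_mul (of Ω G), map_pow (of Ω G),
    map_pow (of Ω G), ← mul_assoc, mul_assoc _ _ (eigenProjector m _ _),
    ← (h.commute_eigenProjector_one.pow_right i).eq, ← mul_assoc,
    h.of_left_pow_mul_eigenProjector_one, mul_assoc, hb, mul_smul_comm]

omit [CharZero Ω] in
/-- The coefficients of a central element are constant on the cosets `⟨a⟩ b ^ i` other than `⟨a⟩`,
each of which lies in a single conjugacy class. -/
theorem coeff_left_pow_mul_right_pow {e : MonoidAlgebra Ω G} (he : ∀ x, Commute e x) {i : ℕ}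
    (hi : ¬ p ∣ i) (j : ℕ) : e.coeff (a ^ j * b ^ i) = e.coeff (b ^ i) := by
  obtain ⟨k, hk⟩ := h.exists_conj hi j
  rw [hk, coeff_mul_comm_of_commute he, mul_assoc, ← zpow_add, neg_add_cancel, zpow_zero, mul_one]

/-- For `ξ ≠ 1` the part of a central element outside `⟨a⟩` annihilates the projector for `ξ`,
because its coefficients are constant on the cosets of `⟨a⟩`. -/
theorem mul_eigenProjector_left {e : MonoidAlgebra Ω G} (he : ∀ x, Commute e x) {ξ : Ω}
    (hξ : ξ ^ m = 1) (h1 : ξ ≠ 1) :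
    e * eigenProjector m (of Ω G a) ξ =
      (∑ j ∈ Finset.range m, e.coeff (a ^ j) * ξ ^ j) • eigenProjector m (of Ω G a) ξ := by
  have hm : (m : Ω) ≠ 0 := Nat.cast_ne_zero.2 h.ne_zero
  conv_lhs => rw [h.eq_sum e]
  rw [Finset.sum_mul, Finset.sum_product_right,
    Finset.sum_eq_single_of_mem 0 (Finset.mem_range.2 h.prime.pos), Finset.sum_smul]
  · refine Finset.sum_congr rfl fun j _ => ?_
    rw [pow_zero, mul_one, smul_mul_assoc, map_pow (of Ω G),
      pow_mul_eigenProjector h.ne_zero h.of_left_pow hξ, smul_smul]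
  · intro i hi hi0
    have hpi : ¬ p ∣ i := Nat.not_dvd_of_pos_of_lt (Nat.pos_of_ne_zero hi0) (Finset.mem_range.1 hi)
    have hconst := h.coeff_left_pow_mul_right_pow he hpi
    have hN : ∑ j ∈ Finset.range m, of Ω G a ^ j =
        (m : Ω) • eigenProjector m (of Ω G a) (1 : Ω) := by
      simp [eigenProjector, smul_inv_smul₀ hm]
    simp_rw [hconst, smul_mul_assoc, map_mul, map_pow]
    rw [← Finset.smul_sum, ← Finset.sum_mul, ← Finset.sum_mul, hN, smul_mul_assoc,
      (h.commute_eigenProjector_one.pow_right i).eq, smul_mul_assoc, mul_assoc,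
      eigenProjector_mul_eigenProjector_of_ne h.ne_zero h.of_left_pow hξ (one_pow m) h1]
    simp

/-- The sum of the coefficients of a central idempotent over a coset of `⟨a⟩` is a rational combination
of `p`-th roots of unity: its Fourier transform gives the eigenvalues of the idempotent on the lines
of the linear characters, and these are `0` or `1`. -/
theorem exists_sum_coeff_eq {e : MonoidAlgebra Ω G} (he : e ∈ centralIdempotents _) {ζ : Ω}
    (hζ : IsPrimitiveRoot ζ p) :
    ∃ q : ℕ → ℚ, ∀ i : ℕ, ∑ j ∈ Finset.range m, e.coeff (a ^ j * b ^ i) =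
      (p : Ω)⁻¹ * ∑ s ∈ Finset.range p, (ζ ^ s)⁻¹ ^ i * q s := by
  have hval : ∀ s : ℕ, ∃ q : ℚ, ∑ i ∈ Finset.range p,
      (∑ j ∈ Finset.range m, e.coeff (a ^ j * b ^ i)) * (ζ ^ s) ^ i = q := fun s => by
    have hs : (ζ ^ s) ^ p = 1 := by rw [pow_right_comm, hζ.pow_eq_one, one_pow]
    rcases eq_zero_or_one_of_idempotent_mul_eq_smul he.1 (h.eigenProjector_one_mul_ne_zero (ζ ^ s))
      (h.mul_eigenProjector_mul e hs) with h0 | h0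
    · exact ⟨0, by simpa using h0⟩
    · exact ⟨1, by simpa using h0⟩
  choose q hq using hval
  refine ⟨q, fun i => ?_⟩
  have hper : Function.Periodic
      (fun i : ℤ => ∑ j ∈ Finset.range m, e.coeff (a ^ j * b ^ i)) p := fun i => by
    simp [zpow_add, h.pow_right]
  have := fourier_inversion h.prime.ne_zero hζ hper i
  simpa [hq] using this

/-- Outside `⟨a⟩` the coefficients of a central idempotent lie in `ℚ(ζ_p)`. -/
theorem coeff_mem_adjoin {e : MonoidAlgebra Ω G} (he : e ∈ centralIdempotents _) {ζ : Ω}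
    (hζ : IsPrimitiveRoot ζ p) {i : ℕ} (hi : ¬ p ∣ i) (j : ℕ) :
    e.coeff (a ^ j * b ^ i) ∈ ℚ⟮ζ⟯ := by
  have hm : (m : Ω) ≠ 0 := Nat.cast_ne_zero.2 h.ne_zero
  have hconst := h.coeff_left_pow_mul_right_pow he.2 hi
  obtain ⟨q, hq⟩ := h.exists_sum_coeff_eq he hζ
  have hsum := hq i
  simp only [hconst, Finset.sum_const, Finset.card_range, nsmul_eq_mul] at hsum
  rw [hconst, ← inv_mul_cancel_left₀ hm (e.coeff (b ^ i)), hsum]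
  have hmem := mem_adjoin_simple_self ℚ ζ
  refine mul_mem (inv_mem (_root_.natCast_mem _ _)) (mul_mem (inv_mem (_root_.natCast_mem _ _))
    (sum_mem fun s _ => mul_mem (pow_mem (inv_mem (pow_mem hmem _)) _) ?_))
  exact SubfieldClass.ratCast_mem _ _

/-- On `⟨a⟩` the coefficients of a central idempotent are rational combinations of `m`-th roots of
unity; being a class function, they are fixed by `ζ_m ↦ ζ_m ^ r`. -/
theorem coeff_pow_mem_powFixedField {e : MonoidAlgebra Ω G} (he : e ∈ centralIdempotents _)
    {ζp ζ : Ω} (hζp : IsPrimitiveRoot ζp p) (hζ : IsPrimitiveRoot ζ m) (j : ℕ) :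
    e.coeff (a ^ j) ∈ powFixedField ζ r := by
  have hval : ∀ s : ℕ, ∃ q : ℚ, ∑ j ∈ Finset.range m, e.coeff (a ^ j) * (ζ ^ s) ^ j = q := by
    intro s
    by_cases h1 : ζ ^ s = 1
    · obtain ⟨q, hq⟩ := h.exists_sum_coeff_eq he hζp
      refine ⟨(p : ℚ)⁻¹ * ∑ s ∈ Finset.range p, q s, ?_⟩
      simpa [h1] using hq 0
    · have hs : (ζ ^ s) ^ m = 1 := by rw [pow_right_comm, hζ.pow_eq_one, one_pow]
      rcases eq_zero_or_one_of_idempotent_mul_eq_smul he.1 (h.eigenProjector_left_ne_zero (ζ ^ s))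
        (h.mul_eigenProjector_left he.2 hs h1) with h0 | h0
      · exact ⟨0, by simpa using h0⟩
      · exact ⟨1, by simpa using h0⟩
  choose q hq using hval
  have hper : Function.Periodic (fun i : ℤ => e.coeff (a ^ i)) m := fun i => by
    simp [zpow_add, h.pow_left]
  have hinv : ∀ j : ℕ, e.coeff (a ^ j) =
      (m : Ω)⁻¹ * ∑ s ∈ Finset.range m, (ζ ^ s)⁻¹ ^ j * q s := fun j => by
    have := fourier_inversion h.ne_zero hζ hper j
    simpa [hq] using this
  have hconj : e.coeff (a ^ (r * j)) = e.coeff (a ^ j) := by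
    have hs : a ^ (r * j) = b⁻¹ * (a ^ j * b) := by
      have := (h.semiconjBy 1).pow_right j
      rw [pow_one, pow_one, ← pow_mul] at this
      rw [← this.eq, inv_mul_cancel_left]
    rw [hs, coeff_mul_comm_of_commute he.2, mul_inv_cancel_right]
  let y : ℕ → ℚ⟮ζ⟯ := fun j =>
    (m : ℚ⟮ζ⟯)⁻¹ * ∑ s ∈ Finset.range m, (AdjoinSimple.gen ℚ ζ ^ s)⁻¹ ^ j * q s
  have hy : ∀ j, (y j : Ω) = e.coeff (a ^ j) := fun j => by
    rw [hinv]
    simp [y]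
  rw [← hy]
  refine coe_mem_powFixedField fun σ hσ => ?_
  have hσy : σ (y j) = y (r * j) := by
    simp only [y, map_mul, map_inv₀, map_natCast, map_sum, map_pow, map_ratCast, hσ,
      zpow_natCast]
    congr 1
    refine Finset.sum_congr rfl fun s _ => ?_
    congr 1
    rw [inv_pow, inv_pow, ← pow_mul, ← pow_mul, ← pow_mul]
    congr 2
    ring
  rw [hσy]
  exact Subtype.ext (by rw [hy, hy, hconj])

/-! ### Central idempotents attached to subfields -/

omit [CharZero Ω] in
theorem mem_centralIdempotents_of_commute {e : MonoidAlgebra Ω G} (he : IsIdempotentElem e)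
    (ha : Commute e (of Ω G a)) (hb : Commute e (of Ω G b)) : e ∈ centralIdempotents _ := by
  refine ⟨he, commute_of_forall_commute_single fun g => ?_⟩
  obtain ⟨x, -, rfl⟩ := h.bijOn.surjOn (Set.mem_univ g)
  change Commute e (of Ω G (a ^ x.1 * b ^ x.2))
  rw [map_mul, map_pow, map_pow]
  exact (ha.pow_right _).mul_right (hb.pow_right _)

/-- If `L ⊆ ℚ(ζ_p)`, the linear characters `b ↦ σ ζ_p` with `σ` in the Galois group over `L` give a
central idempotent with coefficients in `L`, which is not rational unless `L = ℚ`. -/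
theorem eq_bot_of_le_adjoin {L : IntermediateField ℚ Ω} {ζ : Ω} (hζ : IsPrimitiveRoot ζ p)
    (hL : L ≤ ℚ⟮ζ⟯) (hrat : ∀ e ∈ centralIdempotents (MonoidAlgebra Ω G),
      (∀ g, e.coeff g ∈ L) → ∀ g, e.coeff g ∈ (⊥ : IntermediateField ℚ Ω)) : L = ⊥ := by
  obtain ⟨_, _⟩ := hζ.isGalois_adjoin_simple ℚ h.prime.ne_zero
  have hm : (m : Ω) ≠ 0 := Nat.cast_ne_zero.2 h.ne_zero
  have := Fintype.ofFinite (restrict hL).fixingSubgroup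
  set N := eigenProjector m (of Ω G a) (1 : Ω) with hN
  set u := orbitProjector p (of Ω G b) (restrict hL).fixingSubgroup with hu
  have hsum := orbitProjector_eq_sum (n := p) (restrict hL).fixingSubgroup (of Ω G b)
  have hNu : Commute N u := by
    rw [hu, hsum]
    exact h.commute_eigenProjector_one.sum_smul_pow _ _
  have hAN : Commute N (of Ω G a) := ((Commute.refl _).eigenProjector_right m 1).symm
  have hNA : of Ω G a * N = N := by
    rw [← pow_one (of Ω G a)]
    exact h.of_left_pow_mul_eigenProjector_one 1
  have hcentral : N * u ∈ centralIdempotents (MonoidAlgebra Ω G) := by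
    refine h.mem_centralIdempotents_of_commute ?_ ?_ ?_
    · exact IsIdempotentElem.mul_of_commute hNu
        (isIdempotentElem_eigenProjector h.ne_zero h.of_left_pow (one_pow m))
        (isIdempotentElem_orbitProjector _ h.prime.ne_zero hζ.pow_eq_one h.of_right_pow)
    · -- Both products with `a` are `N * u`, since `N` absorbs `a`.
      rw [Commute, SemiconjBy, ← mul_assoc, hNA, hNu.eq, mul_assoc, hAN.eq, hNA]
    · refine h.commute_eigenProjector_one.mul_left ?_
      rw [hu, hsum]
      exact ((Commute.refl _).sum_smul_pow _ _).symm
  have hcoeff : ∀ i < p, (N * u).coeff (b ^ i) =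
      (m : Ω)⁻¹ * orbitCoeff p (restrict hL).fixingSubgroup i := fun i hi => by
    rw [hu, hsum, hN, h.coeff_eigenProjector_one_mul_sum _ hi]
  refine eq_bot_of_orbitCoeff_mem_bot h.prime.ne_zero hζ hL fun i hi => ?_
  have hbot := hrat _ hcentral (fun g => ?_) (b ^ i)
  · rw [hcoeff i hi] at hbot
    rw [← mul_inv_cancel_left₀ hm (orbitCoeff p _ i)]
    exact mul_mem (_root_.natCast_mem _ _) hbot
  · rw [hu, hsum, hN, eigenProjector_one_mul_sum]
    exact coeff_sum_smul_of_mem (fun x _ => mul_mem (inv_mem (_root_.natCast_mem _ _))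
      (orbitCoeff_mem h.prime.ne_zero hζ hL _)) g

/-- If `L ⊆ ℚ(ζ_m)` is fixed by `ζ_m ↦ ζ_m ^ r`, the characters `a ↦ σ ζ_m` of `⟨a⟩` with `σ` in the
Galois group over `L` are permuted by `b`, so the sum of their idempotents is central in the group
algebra; its coefficients lie in `L` and are not rational unless `L = ℚ`. -/
theorem eq_bot_of_le_powFixedField {L : IntermediateField ℚ Ω} {ζ : Ω} (hζ : IsPrimitiveRoot ζ m)
    (hLr : L ≤ powFixedField ζ r) (hrat : ∀ e ∈ centralIdempotents (MonoidAlgebra Ω G),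
      (∀ g, e.coeff g ∈ L) → ∀ g, e.coeff g ∈ (⊥ : IntermediateField ℚ Ω)) : L = ⊥ := by
  have hL : L ≤ ℚ⟮ζ⟯ := hLr.trans (lift_le _)
  obtain ⟨_, _⟩ := hζ.isGalois_adjoin_simple ℚ h.ne_zero
  have := Fintype.ofFinite (restrict hL).fixingSubgroup
  obtain ⟨τ, hτ, hτζ⟩ := exists_mem_fixingSubgroup_gen_zpow h.ne_zero hζ
    (Nat.isCoprime_iff_coprime.2 h.coprime) hL hLr
  set u := orbitProjector m (of Ω G a) (restrict hL).fixingSubgroup with hu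
  have hsum := orbitProjector_eq_sum (n := m) (restrict hL).fixingSubgroup (of Ω G a)
  have hcentral : u ∈ centralIdempotents (MonoidAlgebra Ω G) := by
    refine h.mem_centralIdempotents_of_commute
      (isIdempotentElem_orbitProjector _ h.ne_zero hζ.pow_eq_one h.of_left_pow) ?_ ?_
    · rw [hu, hsum]
      exact ((Commute.refl _).sum_smul_pow _ _).symm
    · rw [Commute, SemiconjBy, hu, orbitProjector, Finset.sum_mul, Finset.mul_sum]
      -- Conjugation by `b` moves the summand of `σ * τ` to that of `σ`, where `τ ζ = ζ ^ r`.
      refine (Fintype.sum_equiv (Equiv.mulRight (⟨τ, hτ⟩ : (restrict hL).fixingSubgroup)) _ _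
        fun σ => ?_).symm
      rw [← h.eigenProjector_pow_mul_of (pow_conjugate_gen hζ.pow_eq_one _)]
      congr 2
      change _ = ((σ.1 (τ (AdjoinSimple.gen ℚ ζ)) : ℚ⟮ζ⟯) : Ω)
      rw [hτζ, zpow_natCast, map_pow]
      rfl
  refine eq_bot_of_orbitCoeff_mem_bot h.ne_zero hζ hL fun i hi => ?_
  have hbot := hrat _ hcentral (fun g => ?_) (a ^ i)
  · rwa [hu, hsum, h.coeff_sum_smul_of_left_pow _ hi] at hbot
  · rw [hu, hsum]
    simp_rw [← map_pow]
    exact coeff_sum_smul_of_mem (fun x _ => orbitCoeff_mem h.ne_zero hζ hL _) g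

/-- The criterion over an arbitrary subfield `K` of `Ω`: all central idempotents with coefficients
in `K` are rational if and only if `K` meets `ℚ(ζ_p)` and the fixed field in `ℚ(ζ_m)` trivially. -/
theorem centralIdempotents_rational_iff (K : IntermediateField ℚ Ω) {ζp ζm : Ω}
    (hζp : IsPrimitiveRoot ζp p) (hζm : IsPrimitiveRoot ζm m) :
    (∀ e ∈ centralIdempotents (MonoidAlgebra Ω G),
      (∀ g, e.coeff g ∈ K) → ∀ g, e.coeff g ∈ (⊥ : IntermediateField ℚ Ω)) ↔
    ℚ⟮ζp⟯ ⊓ K = ⊥ ∧ powFixedField ζm r ⊓ K = ⊥ := by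
  constructor
  · intro hrat
    exact ⟨h.eq_bot_of_le_adjoin hζp inf_le_left fun e he hK => hrat e he fun g => (hK g).2,
      h.eq_bot_of_le_powFixedField hζm inf_le_left fun e he hK => hrat e he fun g => (hK g).2⟩
  · rintro ⟨h1, h2⟩ e he hK g
    obtain ⟨x, -, rfl⟩ := h.bijOn.surjOn (Set.mem_univ g)
    by_cases hx : p ∣ x.2
    · obtain ⟨t, ht⟩ := hx
      have hb : b ^ x.2 = 1 := by rw [ht, pow_mul, h.pow_right, one_pow]
      rw [← h2]
      refine ⟨?_, hK _⟩
      simpa [hb] using h.coeff_pow_mem_powFixedField he hζp hζm x.1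
    · rw [← h1]
      exact ⟨h.coeff_mem_adjoin he hζp hx x.1, hK _⟩

end Algebra

end IsMetacyclicPair

/-! ### The criterion for minimality -/

/-- Extension of scalars to `Ω` turns the criterion for minimality into a statement about subfields
of `Ω`. -/
theorem hasMinimalSimpleComponents_iff_imageField (F Ω G : Type*) [Field F] [NumberField F]
    [Field Ω] [CharZero Ω] [Algebra F Ω] [Group G] [Finite G] :
    HasMinimalSimpleComponents F G ↔ ∀ e ∈ centralIdempotents (MonoidAlgebra Ω G),
      (∀ g, e.coeff g ∈ imageField F Ω) → ∀ g, e.coeff g ∈ (⊥ : IntermediateField ℚ Ω) := by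
  rw [hasMinimalSimpleComponents_iff]
  constructor
  · intro h e he hF g
    obtain ⟨e, rfl⟩ : e ∈ Set.range (MonoidAlgebra.map (M := G) (algebraMap F Ω : F →+ Ω)) := by
      rw [MonoidAlgebra.range_map]
      exact hF
    obtain ⟨q, hq⟩ := h e
      ((MonoidAlgebra.mapRingHom_mem_centralIdempotents_iff (algebraMap F Ω)).1 he) g
    refine mem_bot.2 ⟨q, ?_⟩
    change _ = (MonoidAlgebra.mapRingHom G (algebraMap F Ω) e).coeff g
    rw [MonoidAlgebra.coeff_mapRingHom, ← hq, ← IsScalarTower.algebraMap_apply]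
  · intro h e he g
    obtain ⟨q, hq⟩ := mem_bot.1 (h _
      ((MonoidAlgebra.mapRingHom_mem_centralIdempotents_iff (algebraMap F Ω)).2 he)
      (fun g => ⟨e.coeff g, (MonoidAlgebra.coeff_mapRingHom _ _ g).symm⟩) g)
    refine ⟨q, (algebraMap F Ω).injective ?_⟩
    rw [MonoidAlgebra.coeff_mapRingHom] at hq
    rw [← hq, ← IsScalarTower.algebraMap_apply]

theorem powFixedField_congr {Ω : Type*} [Field Ω] [CharZero Ω] {n : ℕ} (hn : n ≠ 0) {ζ : Ω}
    (hζ : ζ ^ n = 1) {r s : ℤ} (h : (n : ℤ) ∣ r - s) :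
    powFixedField ζ r = powFixedField ζ s := by
  have hg : AdjoinSimple.gen ℚ ζ ^ n = 1 := Subtype.ext (by simpa using hζ)
  have hg0 : AdjoinSimple.gen ℚ ζ ≠ 0 := by
    intro h0
    rw [h0, zero_pow hn] at hg
    exact zero_ne_one hg
  obtain ⟨c, hc⟩ := h
  have hpow : AdjoinSimple.gen ℚ ζ ^ r = AdjoinSimple.gen ℚ ζ ^ s := by
    rw [show r = n * c + s by omega, zpow_add₀ hg0, zpow_mul, zpow_natCast, hg, one_zpow, one_mul]
  rw [powFixedField, powFixedField, powAutGroup, powAutGroup, hpow]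

theorem IsMetacyclicPair.of_isComplement' {G : Type*} [Group G] {a b : G} {m p r : ℕ} (hm : m ≠ 0)
    (hp : p.Prime) (ha : orderOf a = m) (hb : orderOf b = p)
    (hcompl : Subgroup.IsComplement' (Subgroup.zpowers a) (Subgroup.zpowers b))
    (hab : b⁻¹ * a * b = a ^ r) (hr : IsCoprime ((r : ℤ) - 1) (m : ℤ)) :
    IsMetacyclicPair a b m p r where
  ne_zero := hm
  prime := hp
  orderOf_left := ha
  orderOf_right := hb
  bijOn := by
    have hbij : Function.Bijective
        fun x : Subgroup.zpowers a × Subgroup.zpowers b => (x.1 : G) * x.2 := hcompl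
    refine ⟨Set.mapsTo_univ _ _, ?_, ?_⟩
    · rintro ⟨j, i⟩ hx ⟨j', i'⟩ hx' h
      simp only [Finset.coe_product, Finset.coe_range, Set.mem_prod, Set.mem_Iio] at hx hx'
      have := @hbij.1 (⟨a ^ j, Subgroup.npow_mem_zpowers a j⟩, ⟨b ^ i, Subgroup.npow_mem_zpowers b i⟩)
        (⟨a ^ j', Subgroup.npow_mem_zpowers a j'⟩, ⟨b ^ i', Subgroup.npow_mem_zpowers b i'⟩) h
      simp only [Prod.mk.injEq, Subtype.mk.injEq] at this
      exact Prod.ext (pow_injOn_Iio_orderOf (ha ▸ hx.1) (ha ▸ hx'.1) this.1)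
        (pow_injOn_Iio_orderOf (hb ▸ hx.2) (hb ▸ hx'.2) this.2)
    · classical
      intro g _
      obtain ⟨⟨⟨x, hx⟩, ⟨y, hy⟩⟩, rfl⟩ := hbij.2 g
      have hfa : IsOfFinOrder a := orderOf_pos_iff.1 (ha ▸ Nat.pos_of_ne_zero hm)
      have hfb : IsOfFinOrder b := orderOf_pos_iff.1 (hb ▸ hp.pos)
      obtain ⟨j, hj, rfl⟩ := Finset.mem_image.1 (hfa.mem_zpowers_iff_mem_range_orderOf.1 hx)
      obtain ⟨i, hi, rfl⟩ := Finset.mem_image.1 (hfb.mem_zpowers_iff_mem_range_orderOf.1 hy)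
      exact ⟨(j, i), Finset.mem_coe.2 (Finset.mem_product.2 ⟨ha ▸ hj, hb ▸ hi⟩), rfl⟩
  mul_comm_pow := by rw [← hab]; group
  coprime := by
    have horder : orderOf (a ^ r) = orderOf a := by
      rw [← hab]
      simpa using MulEquiv.orderOf_eq (MulAut.conj b⁻¹) a
    have hfa : IsOfFinOrder a := orderOf_pos_iff.1 (ha ▸ Nat.pos_of_ne_zero hm)
    -- `b⁻¹ a b = a ^ r` has the same order as `a`, so `m / gcd(m, r) = m`.
    rw [hfa.orderOf_pow, ha] at horder
    exact (Nat.coprime_comm).1 ((Nat.div_eq_self.1 horder).resolve_left hm)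
  isCoprime_sub_one := hr

theorem IsMetacyclicPair.finite {G : Type*} [Group G] {a b : G} {m p r : ℕ}
    (h : IsMetacyclicPair a b m p r) : Finite G :=
  Set.finite_univ_iff.1 (h.bijOn.image_eq ▸ (Finset.finite_toSet _).image _)

theorem mainTheorem12
    (F : Type*) [Field F] [NumberField F]
    (Ω : Type*) [Field Ω] [CharZero Ω] [Algebra F Ω]
    (G : Type*) [Group G] (a b : G) (m p : ℕ) (r : ℤ)
    (hp : p.Prime) (hpm : ¬ p ∣ m)
    (ha : orderOf a = m) (hb : orderOf b = p)
    (hnormal : (Subgroup.zpowers a).Normal)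
    (hcompl : Subgroup.IsComplement' (Subgroup.zpowers a) (Subgroup.zpowers b))
    (hab : b⁻¹ * a * b = a ^ r)
    (hr : IsCoprime (r - 1) (m : ℤ))
    (ζp ζm : Ω) (hζp : IsPrimitiveRoot ζp p) (hζm : IsPrimitiveRoot ζm m) :
    (HasMinimalSimpleComponents F G ↔
      ℚ⟮ζp⟯ ⊓ imageField F Ω = ⊥ ∧ powFixedField ζm r ⊓ imageField F Ω = ⊥) ∧
    (ℚ⟮ζp⟯ ⊓ imageField F Ω = ⊥ ↔ (cyclotomicGaloisImage F p ζp).ncard = p - 1) := by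
  have : NeZero p := ⟨hp.ne_zero⟩
  have hm : m ≠ 0 := by
    rintro rfl
    exact hpm (dvd_zero p)
  -- Only the class of `r` modulo `m` matters, so `r` may be replaced by a natural number.
  obtain ⟨s, c, rfl⟩ : ∃ (s : ℕ) (c : ℤ), r = s + m * c := by
    have h0 : 0 ≤ r % m := Int.emod_nonneg _ (by exact_mod_cast hm)
    exact ⟨(r % m).toNat, r / m, by rw [Int.toNat_of_nonneg h0, Int.emod_add_mul_ediv]⟩
  have has : b⁻¹ * a * b = a ^ s := by
    rw [hab, zpow_add, zpow_mul, zpow_natCast, zpow_natCast, ← ha, pow_orderOf_eq_one, one_zpow,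
      mul_one]
  have hs : IsCoprime ((s : ℤ) - 1) (m : ℤ) := by
    rw [show (s : ℤ) + m * c - 1 = s - 1 + m * c by ring] at hr
    exact hr.of_add_mul_left_left
  have h := IsMetacyclicPair.of_isComplement' hm hp ha hb hcompl has hs
  have := h.finite
  refine ⟨?_, ?_⟩
  · rw [hasMinimalSimpleComponents_iff_imageField F Ω G,
      h.centralIdempotents_rational_iff (imageField F Ω) hζp hζm,
      powFixedField_congr hm hζm.pow_eq_one (r := s + m * c) (s := s) ⟨c, by ring⟩]
  · rw [adjoin_inf_imageField_eq_bot_iff_ncard F hζp, Nat.totient_prime hp]
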